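/- Call an accessible category $\mathcal K$ \emph{locally multipresentable} if it has all small connected limits, and \emph{locally polypresentable} if it has all small wide pullbacks; call $\mathcal K$ \emph{large} if it is not equivalent to a small category. For an object $M$ of an accessible category $\mathcal K$, let the presentability rank $r_{\mathcal K}(M)$ be the least regular cardinal $\lambda$ such that $M$ is $\lambda$-presentable, and let the internal size $|M|_{\mathcal K}$ be $\mu$ if $r_{\mathcal K}(M)=\mu^+$ is a successor cardinal, and $r_{\mathcal K}(M)$ if $r_{\mathcal K}(M)$ is a limit cardinal. Call $\mathcal K$ \emph{weakly LS-accessible} if there is a cardinal $\lambda$ such that for every regular cardinal $\lambda'\ge\lambda$ there is an object $M$ of $\mathcal K$ with $|M|_{\mathcal K}=\lambda'$. (1) Every large locally multipresentable category is weakly LS-accessible. (2) Every large locally polypresentable category in which all morphisms are monomorphisms is weakly LS-accessible. -/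

import Mathlib

open CategoryTheory CategoryTheory.Limits

universe w v u

namespace LSAccessibility

/-- `r` is the presentability rank of `X`: the least regular cardinal `κ` such that `X` is
`κ`-presentable. (Every object of an accessible category has one.) -/
def IsPresentabilityRank {C : Type u} [Category.{v} C] (X : C) (r : Cardinal.{w}) : Prop :=
  IsLeast {κ : Cardinal.{w} | ∃ _ : Fact κ.IsRegular, IsCardinalPresentable X κ} r

/-- `X` has internal size `μ`: either the presentability rank of `X` is the successor
cardinal `μ⁺`, or it is a limit cardinal and equals `μ`. -/
def HasInternalSize {C : Type u} [Category.{v} C] (X : C) (μ : Cardinal.{w}) : Prop :=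
  ∃ r : Cardinal.{w}, IsPresentabilityRank X r ∧
    (r = Order.succ μ ∨ (Order.IsSuccLimit r ∧ r = μ))

/-- A category is weakly LS-accessible if there is a cardinal `κ` such that it has an object
of internal size exactly `μ` for every regular cardinal `μ ≥ κ`. -/
def IsWeaklyLSAccessible (C : Type u) [Category.{v} C] : Prop :=
  ∃ κ : Cardinal.{w}, ∀ μ : Cardinal.{w}, κ ≤ μ → μ.IsRegular →
    ∃ X : C, HasInternalSize X μ

/-- A category is large (relative to the universe `w`) if it is not equivalent to a small one. -/
def IsLarge (C : Type u) [Category.{v} C] : Prop :=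
  ¬ EssentiallySmall.{w} C

/-- A locally multipresentable category is an accessible category with all (small)
connected limits. -/
structure IsLocallyMultipresentable (C : Type u) [Category.{v} C] : Prop where
  isAccessible : IsAccessibleCategory.{w} C
  hasConnectedLimits (J : Type w) [SmallCategory J] [IsConnected J] : HasLimitsOfShape J C

/-- A locally polypresentable category is an accessible category with all (small)
wide pullbacks. -/
structure IsLocallyPolypresentable (C : Type u) [Category.{v} C] : Prop where
  isAccessible : IsAccessibleCategory.{w} C
  hasWidePullbacks : HasWidePullbacks.{w} C

end LSAccessibility

/-!
Let `C` be a large accessible category whose slices have all small limits; connected limits in `C`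
are more than enough for this, and if all morphisms are monic, then the slices are preorders and
wide pullbacks suffice. Accessible categories satisfy the solution set condition for coproducts of
small families of presentable objects, so by Freyd's argument every slice has such coproducts. The
object `F` underlying a coproduct `∐ B` in `Over K` need not be a coproduct in `C`, but thanks to
pullbacks `∐ B` stays a coproduct after changing the base `K` to any `L` along a map `F ⟶ L`, and
this suffices for `F` to be `λ`-presentable when `B` consists of fewer than `λ` objects that are
`λ`-presentable.

Let `C` be `κ`-accessible and `κ ≤ μ`. Since `C` is large, some `K` is not covered by any of the
essentially small class of coproducts of at most `μ` objects that are `κ`-presentable. Hence there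
are `κ`-presentable objects `B i` over `K`, for `i < μ`, chosen recursively such that `B i` does
not map to `∐_{j < i} B j` over `K`. The coproduct of all of them is `μ⁺`-presentable. It maps to
the `μ`-filtered colimit of the chain `i ↦ ∐_{j < i} B j`, but not to any of its stages, so it is
not `μ`-presentable.
-/

namespace LSAccessibility

section Cardinals

lemma exists_regular_hasCardinalLT_setOf_hasCardinalLT (κ μ : Cardinal.{w}) :
    ∃ l : Cardinal.{w}, l.IsRegular ∧ κ < l ∧ μ < l ∧ ∀ X : Type w, HasCardinalLT X l →
      HasCardinalLT {t : Set X // HasCardinalLT t κ} l := by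
  let ν := max Cardinal.aleph0 (max κ μ)
  have hκν : κ ≤ ν := (le_max_left _ _).trans (le_max_right _ _)
  have hν : ν < Order.succ (2 ^ ν) := (Cardinal.cantor ν).trans (Order.lt_succ _)
  refine ⟨Order.succ (2 ^ ν), Cardinal.isRegular_succ ?_, hκν.trans_lt hν,
    ((le_max_right _ _).trans (le_max_right _ _)).trans_lt hν, fun X hX ↦ ?_⟩
  · exact (le_max_left _ _).trans (Cardinal.cantor ν).le
  rw [hasCardinalLT_iff_cardinal_mk_lt, Order.lt_succ_iff] at hX ⊢
  calc Cardinal.mk {t : Set X // HasCardinalLT t κ}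
    _ ≤ Cardinal.mk {t : Set X // Cardinal.mk t ≤ ν} := Cardinal.mk_subtype_mono fun t ht ↦
        ((hasCardinalLT_iff_cardinal_mk_lt _ _).1 ht).le.trans hκν
    _ ≤ max (Cardinal.mk X) Cardinal.aleph0 ^ ν := Cardinal.mk_bounded_set_le X ν
    _ ≤ (2 ^ ν) ^ ν := Cardinal.power_le_power_right
        (max_le hX ((le_max_left _ _).trans (Cardinal.cantor ν).le))
    _ = 2 ^ ν := by
        rw [← Cardinal.power_mul, Cardinal.mul_eq_self (le_max_left _ _)]

lemma hasCardinalLT_arrow_of_preorder {κ : Cardinal.{w}} (hκ : Cardinal.aleph0 ≤ κ)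
    {X : Type u} [Preorder X] (hX : HasCardinalLT X κ) : HasCardinalLT (Arrow X) κ :=
  (hasCardinalLT_prod hκ hX hX).of_injective (fun f ↦ (f.left, f.right)) (by
    rintro ⟨_, _, f⟩ ⟨_, _, g⟩ h
    obtain ⟨rfl, rfl⟩ := Prod.mk.inj h
    obtain rfl := Subsingleton.elim f g
    rfl)

lemma exists_forall_rel_restrict_Iio {I E : Type*} [Preorder I] [WellFoundedLT I]
    {R : ∀ i : I, (Set.Iio i → E) → E → Prop} (hR : ∀ i a, ∃ e, R i a e) :
    ∃ s : I → E, ∀ i, R i (fun j ↦ s j) (s i) := by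
  choose next hnext using hR
  let s : I → E := wellFounded_lt.fix fun i rec ↦ next i fun j ↦ rec j.1 j.2
  have hs (i : I) : s i = next i fun j ↦ s j := WellFounded.fix_eq _ _ _
  exact ⟨s, fun i ↦ (hs i).symm ▸ hnext i _⟩

end Cardinals

section SolutionClass

variable {D : Type*} [Category* D] {S : Type*} {B : S → D} {Q : ObjectProperty D}

/-- `Q` is a solution class for the coproduct of the family `B` if it satisfies Freyd's solution
set condition: every cofan on `B` receives a morphism of cofans from one whose point is
in `Q`. -/
def IsSolutionClass (Q : ObjectProperty D) (B : S → D) : Prop :=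
  ∀ ⦃X : D⦄ (c : ∀ s, B s ⟶ X), ∃ (H : D) (d : ∀ s, B s ⟶ H) (k : H ⟶ X),
    Q H ∧ ∀ s, d s ≫ k = c s

lemma hasInitial_of_small_weakly_initial [LocallySmall.{w} D]
    [HasLimitsOfSize.{w, w} D] {ι : Type*} [Small.{w} ι] (H : ι → D)
    (hH : ∀ X, ∃ i, Nonempty (H i ⟶ X)) : HasInitial D := by
  let e := ShrinkHoms.equivalence.{w} D
  have : HasLimitsOfSize.{w, w} (ShrinkHoms D) :=
    ⟨fun J _ ↦ Adjunction.hasLimitsOfShape_of_equivalence e.inverse⟩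
  obtain ⟨T, hT⟩ := has_weakly_initial_of_weakly_initial_set_and_hasProducts
    (B := fun i : Shrink.{w} ι ↦ e.functor.obj (H ((equivShrink ι).symm i))) (fun A ↦ by
      obtain ⟨i, ⟨f⟩⟩ := hH (e.inverse.obj A)
      exact ⟨equivShrink ι i, ⟨eqToHom (by simp) ≫ e.functor.map f ≫ e.counit.app A⟩⟩)
  have := hasInitial_of_weakly_initial_and_hasWideEqualizers hT
  exact e.hasInitial_iff.2 this

lemma hasColimit_of_small_weakly_initial [LocallySmall.{w} D] [HasLimitsOfSize.{w, w} D]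
    {J : Type*} [Category* J] {F : J ⥤ D} {ι : Type*} [Small.{w} ι]
    (H : ι → Cocone F) (hH : ∀ c, ∃ i, Nonempty (H i ⟶ c)) : HasColimit F := by
  have : (Cocone.forget F).Faithful := ⟨fun h ↦ by ext; exact h⟩
  have := locallySmall_of_faithful.{w} (Cocone.forget F)
  have : HasLimitsOfSize.{w, w} (Cocone F) :=
    ⟨fun _ _ ↦ Adjunction.hasLimitsOfShape_of_equivalence (Cocone.equivStructuredArrow F).functor⟩
  rw [hasColimit_iff_hasInitial_cocone]
  exact hasInitial_of_small_weakly_initial H hH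

lemma IsSolutionClass.hasCoproduct [LocallySmall.{w} D] [HasLimitsOfSize.{w, w} D]
    [ObjectProperty.EssentiallySmall.{w} Q] [Small.{w} S] (hQ : IsSolutionClass Q B) :
    HasCoproduct B := by
  obtain ⟨Q', _, -, hQ'⟩ := ObjectProperty.EssentiallySmall.exists_small_le.{w} Q
  have : Small.{w} (Subtype Q') := inferInstanceAs (ObjectProperty.Small.{w} Q')
  refine hasColimit_of_small_weakly_initial.{w}
    (fun x : Σ H : Subtype Q', ∀ s, B s ⟶ H.1 ↦ Cofan.mk x.1.1 x.2) (fun c ↦ ?_)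
  obtain ⟨H, d, k, hH, hd⟩ := hQ (fun s ↦ c.ι.app ⟨s⟩)
  obtain ⟨H', hH', ⟨e⟩⟩ := hQ' _ hH
  exact ⟨⟨⟨H', hH'⟩, fun s ↦ d s ≫ e.hom⟩, ⟨⟨e.inv ≫ k, fun ⟨s⟩ ↦ by simp [hd]⟩⟩⟩

lemma IsSolutionClass.prop_sigma [Q.IsStableUnderRetracts] [HasCoproduct B]
    (hQ : IsSolutionClass Q B) : Q (∐ B) := by
  obtain ⟨H, d, k, hH, hd⟩ := hQ (Sigma.ι B)
  exact Q.prop_of_retract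
    { i := Limits.Sigma.desc d, r := k, retract := by ext; simp [hd] } hH

lemma IsSolutionClass.over {K : D} {B : S → Over K} (hQ : IsSolutionClass Q fun s ↦ (B s).left) :
    IsSolutionClass (Q.inverseImage (Over.forget K)) B := fun X c ↦ by
  obtain ⟨H, d, k, hH, hd⟩ := hQ fun s ↦ (c s).left
  exact ⟨Over.mk (k ≫ X.hom), fun s ↦ Over.homMk (d s) (by simp [reassoc_of% hd]), Over.homMk k,
    hH, fun s ↦ by ext; exact hd s⟩

instance isStableUnderRetracts_inverseImage_overForget {K : D} [Q.IsStableUnderRetracts] :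
    (Q.inverseImage (Over.forget K)).IsStableUnderRetracts where
  of_retract h hY := Q.prop_of_retract (h.map (Over.forget K)) hY

instance small_inverseImage_overForget {K : D} [ObjectProperty.Small.{w} Q] [LocallySmall.{w} D] :
    ObjectProperty.Small.{w} (Q.inverseImage (Over.forget K)) := by
  have : Small.{w} (Subtype Q) := inferInstanceAs (ObjectProperty.Small.{w} Q)
  refine .of_le (Q := .ofObj fun f : Σ A : Subtype Q, A.1 ⟶ K ↦ Over.mk f.2) fun X hX ↦ ?_
  exact (ObjectProperty.ofObj_iff _ _).2 ⟨⟨⟨X.left, hX⟩, X.hom⟩, rfl⟩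

instance essentiallySmall_inverseImage_overForget {K : D} [ObjectProperty.EssentiallySmall.{w} Q]
    [LocallySmall.{w} D] :
    ObjectProperty.EssentiallySmall.{w} (Q.inverseImage (Over.forget K)) := by
  obtain ⟨Q', _, -, hQ'⟩ := ObjectProperty.EssentiallySmall.exists_small_le.{w} Q
  refine ⟨Q'.inverseImage (Over.forget K), inferInstance, fun X hX ↦ ?_⟩
  obtain ⟨H, hH, ⟨e⟩⟩ := hQ' _ hX
  exact ⟨Over.mk (e.inv ≫ X.hom), hH, ⟨Over.isoMk e (e.hom_inv_id_assoc X.hom)⟩⟩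

end SolutionClass

section Accessible

variable {C : Type u} [Category.{v} C] {κ : Cardinal.{w}} [Fact κ.IsRegular]
  [IsCardinalAccessibleCategory C κ]

lemma isSolutionClass_colimitsCardinalClosure {l : Cardinal.{w}} [Fact l.IsRegular] (hκl : κ < l)
    (hl : ∀ X : Type w, HasCardinalLT X l → HasCardinalLT {t : Set X // HasCardinalLT t κ} l)
    {S : Type w} (hS : HasCardinalLT S l) {A : S → C} (hA : ∀ s, IsCardinalPresentable (A s) κ) :
    IsSolutionClass ((isCardinalPresentable C κ).colimitsCardinalClosure l) A := fun X c ↦ by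
  obtain ⟨J, _, _, ⟨p⟩⟩ :=
    (isCardinalFilteredGenerator_isCardinalPresentable C κ).exists_colimitsOfShape X
  obtain ⟨α, _, _, q, _⟩ := IsCardinalFiltered.exists_cardinal_directed J κ
  have hX : IsColimit (p.cocone.whisker q) :=
    (Functor.Final.isColimitWhiskerEquiv q _).symm p.isColimit
  choose a d hd using fun s ↦ IsCardinalPresentable.exists_hom_of_isColimit κ hX (c s)
  -- The stages `a s` lie in a `κ`-directed `B` of size `< l`; take the colimit over `B`.
  obtain ⟨B, haB, _, hB⟩ := Cardinal.SharplyLT.exists_isCardinalFiltered_set_of_exists_cofinal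
    hκl (fun X hX ↦ ⟨Set.univ, (hl X hX).of_injective Subtype.val Subtype.val_injective,
      IsCofinal.univ⟩)
    (Set.range a) (hS.of_surjective _ Set.rangeFactorization_surjective)
  let i : B ⥤ α := Monotone.functor (f := Subtype.val) (fun _ _ h ↦ h)
  have := HasCardinalFilteredColimits.hasColimitsOfShape (κ := κ) C B
  have := (isCardinalPresentable C κ).isClosedUnderColimitsOfShape_colimitsCardinalClosure l B
    (hasCardinalLT_arrow_of_preorder (Fact.out : l.IsRegular).aleph0_le hB)
  let b (s : S) : B := ⟨a s, haB ⟨s, rfl⟩⟩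
  refine ⟨colimit (i ⋙ q ⋙ p.diag), fun s ↦ d s ≫ colimit.ι (i ⋙ q ⋙ p.diag) (b s),
    colimit.desc _ ((p.cocone.whisker q).whisker i), ?_, fun s ↦ ?_⟩
  · exact ObjectProperty.prop_colimit _ _
      (fun j ↦ ObjectProperty.le_colimitsCardinalClosure _ _ _ (p.prop_diag_obj _))
  · exact (Category.assoc _ _ _).trans ((congrArg (d s ≫ ·) (colimit.ι_desc _ (b s))).trans (hd s))

variable (κ)

lemma exists_isSolutionClass_of_hasCardinalLT (μ : Cardinal.{w}) :
    ∃ Q : ObjectProperty C, ObjectProperty.EssentiallySmall.{w} Q ∧ Q.IsStableUnderRetracts ∧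
      ∀ (S : Type w) (A : S → C), HasCardinalLT S μ → (∀ s, IsCardinalPresentable (A s) κ) →
        IsSolutionClass Q A := by
  obtain ⟨l, hl, hκl, hμl, hsub⟩ := exists_regular_hasCardinalLT_setOf_hasCardinalLT κ μ
  have : Fact l.IsRegular := ⟨hl⟩
  exact ⟨_, inferInstance, inferInstance, fun S A hS hA ↦
    isSolutionClass_colimitsCardinalClosure hκl hsub (hS.of_le hμl.le) hA⟩

lemma hasCoproduct_over {K : C} [HasLimitsOfSize.{w, w} (Over K)] {S : Type w}
    {B : S → Over K} (hB : ∀ s, IsCardinalPresentable (B s).left κ) : HasCoproduct B := by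
  obtain ⟨Q, _, -, hQ⟩ := exists_isSolutionClass_of_hasCardinalLT (C := C) κ
    (Order.succ (Cardinal.mk S))
  have : LocallySmall.{w} C := HasCardinalFilteredGenerator.toLocallySmall κ
  exact (hQ S _ (by simp [hasCardinalLT_iff_cardinal_mk_lt]) hB).over.hasCoproduct

end Accessible

section Large

variable {C : Type u} [Category.{v} C]

lemma hasCardinalLT_arrow_costructuredArrow {S : Type*} [Category* S] {G : S ⥤ C} {K : C}
    {l : Cardinal.{w}} (hK : HasCardinalLT (Σ f : Arrow S, G.obj f.right ⟶ K) l) :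
    HasCardinalLT (Arrow (CostructuredArrow G K)) l :=
  hK.of_surjective (fun ⟨f, y⟩ ↦ Arrow.mk (CostructuredArrow.homMk f.hom rfl :
    CostructuredArrow.mk (G.map f.hom ≫ y) ⟶ CostructuredArrow.mk y)) (by
      rintro ⟨X, Y, φ⟩
      obtain ⟨X, x, rfl⟩ := X.mk_surjective
      obtain ⟨Y, y, rfl⟩ := Y.mk_surjective
      obtain ⟨f : X ⟶ Y, hf, rfl⟩ := CostructuredArrow.homMk_surjective φ
      obtain rfl : G.map f ≫ y = x := hf
      exact ⟨⟨Arrow.mk f, y⟩, rfl⟩)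

lemma colimitsCardinalClosure_of_isDense {S : Type*} [Category* S] {P : ObjectProperty C}
    {G : S ⥤ C} [G.IsDense] (hG : ∀ s, P (G.obj s)) {l : Cardinal.{w}} {K : C}
    (hK : HasCardinalLT (Σ f : Arrow S, G.obj f.right ⟶ K) l) :
    P.colimitsCardinalClosure l K := by
  have := P.isClosedUnderColimitsOfShape_colimitsCardinalClosure l (CostructuredArrow G K)
    (hasCardinalLT_arrow_costructuredArrow hK)
  exact ObjectProperty.prop_of_isColimit _ (G.denseAt K)
    fun X ↦ P.le_colimitsCardinalClosure _ _ (hG _)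

lemma IsLarge.exists_forall_exists_ne_comp (hC : IsLarge.{w} C) [LocallySmall.{w} C]
    (P Q : ObjectProperty C) [ObjectProperty.EssentiallySmall.{w} P] [P.ι.IsDense]
    [ObjectProperty.EssentiallySmall.{w} Q] :
    ∃ K : C, ∀ (F : C) (g : F ⟶ K), Q F → ∃ (A : C) (a : A ⟶ K), P A ∧ ∀ x : A ⟶ F, x ≫ g ≠ a := by
  -- Otherwise every `K` has at most as many `P`-points as some `F` in `Q`, so density bounds the
  -- size of the colimit of objects of `P` which presents `K`.
  by_contra! hQ
  let G : SmallModel.{w} P.FullSubcategory ⥤ C := (equivSmallModel.{w} _).inverse ⋙ P.ι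
  have hG (s) : P (G.obj s) := ((equivSmallModel.{w} P.FullSubcategory).inverse.obj s).property
  obtain ⟨Q', _, -, hQ'⟩ := ObjectProperty.EssentiallySmall.exists_small_le.{w} Q
  have : Small.{w} (Subtype Q') := inferInstanceAs (ObjectProperty.Small.{w} Q')
  obtain ⟨l, -, hl⟩ := HasCardinalLT.exists_regular_cardinal_forall.{w}
    (fun F : Subtype Q' ↦ Σ f : Arrow (SmallModel.{w} P.FullSubcategory), G.obj f.right ⟶ F.1)
  refine hC (essentiallySmall_iff_objectPropertyEssentiallySmall.2 ⟨inferInstance,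
    .of_le (Q := P.colimitsCardinalClosure l) fun K _ ↦ ?_⟩)
  obtain ⟨F, g, hF, hg⟩ := hQ K
  obtain ⟨F', hF', ⟨e⟩⟩ := hQ' _ hF
  refine colimitsCardinalClosure_of_isDense hG ((hl ⟨F', hF'⟩).of_surjective
    (Sigma.map id fun f x ↦ x ≫ e.inv ≫ g) (Function.surjective_id.sigma_map fun f a ↦ ?_))
  obtain ⟨x, rfl⟩ := hg _ a (hG f.right)
  exact ⟨x ≫ e.hom, by simp⟩

lemma IsLarge.exists_isEmpty_hom_sigma_Iio (hC : IsLarge.{w} C) (κ : Cardinal.{w})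
    [Fact κ.IsRegular] [IsCardinalAccessibleCategory C κ]
    [∀ K : C, HasLimitsOfSize.{w, w} (Over K)] (I : Type w) [Preorder I] [WellFoundedLT I] :
    ∃ (K : C) (B : I → Over K), (∀ i, IsCardinalPresentable (B i).left κ) ∧
      ∀ (i : I) [HasCoproduct fun j : Set.Iio i ↦ B j],
        IsEmpty (B i ⟶ ∐ fun j : Set.Iio i ↦ B j) := by
  obtain ⟨Q, _, _, hQ⟩ := exists_isSolutionClass_of_hasCardinalLT (C := C) κ
    (Order.succ (Cardinal.mk I))
  have : LocallySmall.{w} C := HasCardinalFilteredGenerator.toLocallySmall κ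
  obtain ⟨K, hK⟩ := hC.exists_forall_exists_ne_comp (isCardinalPresentable C κ) Q
  have hI : HasCardinalLT I (Order.succ (Cardinal.mk I)) := by
    simp [hasCardinalLT_iff_cardinal_mk_lt]
  obtain ⟨B, hB⟩ := exists_forall_rel_restrict_Iio
    (I := I) (E := {Y : Over K // IsCardinalPresentable Y.left κ})
    (R := fun i B Y ↦ ∀ [HasCoproduct fun j ↦ (B j).1], IsEmpty (Y.1 ⟶ ∐ fun j ↦ (B j).1))
    (fun i B ↦ by
      have := hasCoproduct_over κ fun j ↦ (B j).2
      obtain ⟨A, a, hA, ha⟩ := hK _ (∐ fun j ↦ (B j).1).hom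
        (hQ _ _ (hI.of_injective _ Subtype.val_injective) fun j ↦ (B j).2).over.prop_sigma
      exact ⟨⟨Over.mk a, hA⟩, fun {_} ↦ ⟨fun f ↦ ha f.left (Over.w f)⟩⟩)
  exact ⟨K, fun i ↦ (B i).1, fun i ↦ (B i).2, hB⟩

end Large

section LocalCoproduct

/-- A family of morphisms `b s : A s ⟶ F` is a local coproduct if, for every `h : F ⟶ L`, it
exhibits `F` as the coproduct of the `A s` in the slice over `L`. Coproducts in a slice of a
category with pullbacks have this property, which no longer refers to a chosen base object. -/
def IsLocalCoproduct {C : Type*} [Category* C] {S : Type*} {A : S → C} {F : C}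
    (b : ∀ s, A s ⟶ F) : Prop :=
  ∀ ⦃L X : C⦄ (h : F ⟶ L) (k : X ⟶ L) (c : ∀ s, A s ⟶ X), (∀ s, c s ≫ k = b s ≫ h) →
    ∃! f : F ⟶ X, f ≫ k = h ∧ ∀ s, b s ≫ f = c s

variable {C : Type*} [Category* C]

lemma existsUnique_section_of_sigma_over {S : Type*} {K : C} {B : S → Over K} [HasCoproduct B]
    {X : C} {p : X ⟶ (∐ B).left} {x : ∀ s, (B s).left ⟶ X}
    (hx : ∀ s, x s ≫ p = (Sigma.ι B s).left) :
    ∃! t : (∐ B).left ⟶ X, t ≫ p = 𝟙 _ ∧ ∀ s, (Sigma.ι B s).left ≫ t = x s := by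
  let P : Over K := Over.mk (p ≫ (∐ B).hom)
  let y (s : S) : B s ⟶ P := Over.homMk (x s) (by simp [P, reassoc_of% hx])
  have hy (s : S) : Sigma.ι B s ≫ Limits.Sigma.desc y = y s := Sigma.ι_desc y s
  have hyp : Limits.Sigma.desc y ≫ Over.homMk p = 𝟙 (∐ B) :=
    Sigma.hom_ext _ _ fun s ↦ by ext; simp [y, hx]
  refine ⟨(Limits.Sigma.desc y).left, ⟨congrArg CommaMorphism.left hyp,
    fun s ↦ congrArg CommaMorphism.left (hy s)⟩, fun t ⟨htp, ht⟩ ↦ ?_⟩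
  have hty : Over.homMk t (by simp [P, reassoc_of% htp]) = Limits.Sigma.desc y :=
    Sigma.hom_ext _ _ fun s ↦ by ext; simp [y, ht]
  exact congrArg CommaMorphism.left hty

lemma isLocalCoproduct_sigmaι [HasPullbacks C] {S : Type*} {K : C} (B : S → Over K)
    [HasCoproduct B] : IsLocalCoproduct fun s ↦ (Sigma.ι B s).left := by
  intro L X h k c hc
  obtain ⟨t, ⟨hfst, hι⟩, ht⟩ := existsUnique_section_of_sigma_over (p := pullback.fst h k)
    (x := fun s ↦ pullback.lift (Sigma.ι B s).left (c s) (hc s).symm)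
    (fun s ↦ pullback.lift_fst _ _ _)
  refine ⟨t ≫ pullback.snd h k, ⟨?_, fun s ↦ ?_⟩, fun f ⟨hf, hfc⟩ ↦ ?_⟩
  · rw [Category.assoc, ← pullback.condition, reassoc_of% hfst]
  · rw [reassoc_of% hι s, pullback.lift_snd]
  · have hlift (s : S) : (Sigma.ι B s).left ≫ pullback.lift (𝟙 _) f (by simp [hf]) =
        pullback.lift (Sigma.ι B s).left (c s) (hc s).symm := by
      apply pullback.hom_ext
      · rw [Category.assoc, pullback.lift_fst, pullback.lift_fst, Category.comp_id]
      · rw [Category.assoc, pullback.lift_snd, pullback.lift_snd, hfc s]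
    rw [← ht _ ⟨pullback.lift_fst _ _ _, hlift⟩, pullback.lift_snd]

lemma hasPullbacks_of_hasBinaryProducts_over (C : Type*) [Category* C]
    [∀ K : C, HasBinaryProducts (Over K)] : HasPullbacks C := by
  have (X Y Z : C) (f : X ⟶ Z) (g : Y ⟶ Z) : HasPullback f g :=
    (Over.isPullback_of_binaryFan_isLimit _ (prodIsProd (Over.mk f) (Over.mk g))).hasPullback
  exact hasPullbacks_of_hasLimit_cospan C

section

variable {S : Type w} {A : S → C} {F : C} {b : ∀ s, A s ⟶ F} (κ : Cardinal.{w})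
  [Fact κ.IsRegular] [∀ s, IsCardinalPresentable (A s) κ] {J : Type w} [SmallCategory J]
  [IsCardinalFiltered J κ] {D : J ⥤ C} {c : Cocone D}

lemma IsLocalCoproduct.exists_hom_of_isColimit (hb : IsLocalCoproduct b) (hS : HasCardinalLT S κ)
    (hc : IsColimit c) (f : F ⟶ c.pt) : ∃ (j : J) (g : F ⟶ D.obj j), g ≫ c.ι.app j = f := by
  have := essentiallySmallSelf J
  choose j g hg using fun s ↦ IsCardinalPresentable.exists_hom_of_isColimit κ hc (b s ≫ f)
  obtain ⟨f', ⟨hf', -⟩, -⟩ := hb f (c.ι.app (IsCardinalFiltered.max j hS))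
    (fun s ↦ g s ≫ D.map (IsCardinalFiltered.toMax j hS s)) (fun s ↦ by simp [hg])
  exact ⟨_, f', hf'⟩

lemma IsLocalCoproduct.exists_eq_of_isColimit (hb : IsLocalCoproduct b) (hS : HasCardinalLT S κ)
    (hc : IsColimit c) {j : J} {f g : F ⟶ D.obj j} (hfg : f ≫ c.ι.app j = g ≫ c.ι.app j) :
    ∃ (j' : J) (u : j ⟶ j'), f ≫ D.map u = g ≫ D.map u := by
  have := essentiallySmallSelf J
  choose i u hu using fun s ↦ IsCardinalPresentable.exists_eq_of_isColimit' κ hc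
    (b s ≫ f) (b s ≫ g) (by simp [hfg])
  obtain ⟨m, a, v, hv⟩ := IsCardinalFiltered.wideSpan u hS
  have hbv (s : S) : b s ≫ g ≫ D.map v = b s ≫ f ≫ D.map v := by
    simpa [← D.map_comp, hv] using (hu s =≫ D.map (a s)).symm
  exact ⟨m, v, (hb (f ≫ c.ι.app j) (c.ι.app m) (fun s ↦ b s ≫ f ≫ D.map v)
    (by simp)).unique ⟨by simp, fun _ ↦ rfl⟩ ⟨by simp [hfg], hbv⟩⟩

end

lemma IsLocalCoproduct.isCardinalPresentable {S : Type w} {A : S → C} {F : C} {b : ∀ s, A s ⟶ F}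
    (hb : IsLocalCoproduct b) (κ : Cardinal.{w}) [Fact κ.IsRegular]
    [∀ s, IsCardinalPresentable (A s) κ] (hS : HasCardinalLT S κ) :
    IsCardinalPresentable F κ where
  preservesColimitOfShape J _ _ := ⟨fun {D} ↦ ⟨fun {c} hc ↦ ⟨by
    have := isFiltered_of_isCardinalFiltered J κ
    exact Types.FilteredColimit.isColimitOf' _ _
      (fun f ↦ (hb.exists_hom_of_isColimit κ hS hc f).imp fun _ ⟨g, hg⟩ ↦ ⟨g, hg.symm⟩)
      (fun _ _ _ h ↦ hb.exists_eq_of_isColimit κ hS hc h)⟩⟩⟩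

end LocalCoproduct

section SegmentChain

/-- The chain `i ↦ ∐_{j < i} B j` of coproducts of the proper initial segments of a
transfinite sequence `B`. -/
noncomputable def sigmaIio {D : Type*} [Category* D] {I : Type*} [Preorder I] (B : I → D)
    [∀ i : I, HasCoproduct fun j : Set.Iio i ↦ B j] : I ⥤ D where
  obj i := ∐ fun j : Set.Iio i ↦ B j
  map f := Sigma.map' (fun j ↦ ⟨j, j.2.trans_le (leOfHom f)⟩) fun j ↦ 𝟙 (B j)

variable {C : Type u} [Category.{v} C]

lemma exists_over_hom_of_isColimit (κ : Cardinal.{w}) [Fact κ.IsRegular] {K : C} {Y : Over K}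
    [IsCardinalPresentable Y.left κ] {J : Type w} [SmallCategory J] [IsCardinalFiltered J κ]
    [HasColimitsOfShape J C] {F : J ⥤ Over K} {c : Cocone F} (hc : IsColimit c) (f : Y ⟶ c.pt) :
    ∃ (j : J) (g : Y ⟶ F.obj j), g ≫ c.ι.app j = f := by
  have := essentiallySmallSelf J
  obtain ⟨j, g, hg⟩ : ∃ (j : J) (g : Y.left ⟶ (F.obj j).left), g ≫ (c.ι.app j).left = f.left :=
    IsCardinalPresentable.exists_hom_of_isColimit κ (isColimitOfPreserves (Over.forget K) hc) f.left
  have hw : (c.ι.app j).left ≫ c.pt.hom = (F.obj j).hom := Over.w (c.ι.app j)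
  exact ⟨j, Over.homMk g (by rw [← hw, reassoc_of% hg, Over.w]), by ext; exact hg⟩

lemma not_isCardinalPresentable_sigma_left {μ : Cardinal.{w}} [Fact μ.IsRegular]
    {I : Type w} [Preorder I] [SuccOrder I] [NoMaxOrder I] [IsCardinalFiltered I μ]
    [HasColimitsOfShape I C] {K : C} {B : I → Over K} [HasCoproduct B]
    [∀ i : I, HasCoproduct fun j : Set.Iio i ↦ B j]
    (hB : ∀ i : I, IsEmpty (B i ⟶ ∐ fun j : Set.Iio i ↦ B j)) :
    ¬ IsCardinalPresentable (∐ B).left μ := fun _ ↦ by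
  let f : ∐ B ⟶ colimit (sigmaIio B) := Limits.Sigma.desc fun i ↦
    Sigma.ι (fun j : Set.Iio (Order.succ i) ↦ B j) ⟨i, Order.lt_succ i⟩ ≫
      colimit.ι (sigmaIio B) (Order.succ i)
  obtain ⟨i, g, -⟩ := exists_over_hom_of_isColimit μ (colimit.isColimit (sigmaIio B)) f
  exact (hB i).false (Sigma.ι B i ≫ g)

end SegmentChain

section Main

variable {C : Type u} [Category.{v} C]

lemma hasInternalSize_of_isCardinalPresentable_succ {X : C} {μ : Cardinal.{w}}
    [hμ : Fact μ.IsRegular] [Fact (Order.succ μ).IsRegular]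
    (h₁ : IsCardinalPresentable X (Order.succ μ)) (h₂ : ¬ IsCardinalPresentable X μ) :
    HasInternalSize X μ := by
  refine ⟨Order.succ μ, ⟨⟨inferInstance, h₁⟩, fun κ ⟨_, hκ⟩ ↦ ?_⟩, Or.inl rfl⟩
  by_contra! hlt
  exact h₂ (isCardinalPresentable_of_le X (Order.lt_succ_iff.1 hlt))

lemma IsLocallyMultipresentable.hasLimitsOfSize_over (h : IsLocallyMultipresentable.{w} C)
    (K : C) : HasLimitsOfSize.{w, w} (Over K) where
  has_limits_of_shape J _ := by
    have : IsConnected (WithTerminal J) := isConnected_of_hasTerminal _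
    have := h.hasConnectedLimits (WithTerminal J)
    infer_instance

lemma hasLimitsOfSize_over_of_mono [HasWidePullbacks.{w} C]
    (hmono : ∀ (X Y : C) (f : X ⟶ Y), Mono f) (K : C) : HasLimitsOfSize.{w, w} (Over K) := by
  have : HasProducts.{w} (Over K) := Over.ConstructProducts.over_products_of_widePullbacks
  have : Quiver.IsThin (Over K) := fun X Y ↦ ⟨fun f g ↦ by
    have := hmono _ _ Y.hom
    ext
    rw [← cancel_mono Y.hom, Over.w, Over.w]⟩
  have : HasEqualizers (Over K) := inferInstance
  exact has_limits_of_hasEqualizers_and_products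

end Main

end LSAccessibility

open LSAccessibility in
theorem mainTheorem8_general (C : Type u) [Category.{v} C] [IsAccessibleCategory.{w} C]
    (hC : IsLarge.{w} C) [∀ K : C, HasLimitsOfSize.{w, w} (Over K)] :
    IsWeaklyLSAccessible.{w} C := by
  obtain ⟨κ, _, _⟩ := IsAccessibleCategory.exists_cardinal.{w} C
  refine ⟨κ, fun μ hκμ hμ ↦ ?_⟩
  have : Fact μ.IsRegular := ⟨hμ⟩
  have : Fact (Order.succ μ).IsRegular := ⟨Cardinal.isRegular_succ hμ.aleph0_le⟩
  have : NoMaxOrder μ.ord.ToType := Cardinal.noMaxOrder hμ.aleph0_le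
  have := IsCardinalFiltered.of_le μ.ord.ToType hκμ
  have := HasCardinalFilteredColimits.hasColimitsOfShape (κ := κ) C μ.ord.ToType
  have := hasPullbacks_of_hasBinaryProducts_over C
  obtain ⟨K, B, hB, hBempty⟩ := hC.exists_isEmpty_hom_sigma_Iio κ μ.ord.ToType
  have := hasCoproduct_over κ hB
  have (i : μ.ord.ToType) : HasCoproduct fun j : Set.Iio i ↦ B j :=
    hasCoproduct_over κ fun j ↦ hB j
  have (i : μ.ord.ToType) : IsCardinalPresentable (B i).left (Order.succ μ) :=
    have := hB i
    isCardinalPresentable_of_le (κ := κ) _ (hκμ.trans (Order.le_succ μ))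
  exact ⟨(∐ B).left, hasInternalSize_of_isCardinalPresentable_succ
    ((isLocalCoproduct_sigmaι B).isCardinalPresentable _
      (by simp [hasCardinalLT_iff_cardinal_mk_lt]))
    (not_isCardinalPresentable_sigma_left fun i ↦ hBempty i)⟩

theorem mainTheorem8 (C : Type u) [Category.{v} C] (hC : LSAccessibility.IsLarge.{w} C) :
    (LSAccessibility.IsLocallyMultipresentable.{w} C →
      LSAccessibility.IsWeaklyLSAccessible.{w} C) ∧
    (LSAccessibility.IsLocallyPolypresentable.{w} C →
      (∀ (X Y : C) (f : X ⟶ Y), Mono f) →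
        LSAccessibility.IsWeaklyLSAccessible.{w} C) := by
  refine ⟨fun h ↦ ?_, fun h hmono ↦ ?_⟩
  · have := h.isAccessible
    have := h.hasLimitsOfSize_over
    exact mainTheorem8_general C hC
  · have := h.isAccessible
    have := h.hasWidePullbacks
    have := LSAccessibility.hasLimitsOfSize_over_of_mono hmono
    exact mainTheorem8_general C hC
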